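/- **Theorem 1.7.** *Matrices.* For integers $n>0$ and $m,k\ge 0$, let $\mathrm{matr}_\ast(n,m,k)$ be the set of extended matrices $\mathrm{M}=(x_{ij})_{1\le i\le n,\,1\le j\le m+1}$ with $n$ rows, $m$ left columns and one right column (the column $j=m+1$), whose entries lie in $\{\ast,x_1,\dots,x_k\}$, and let $\mathrm{matr}(n,m,k)$ be the subset of those not containing $\ast$. Let $\mathrm{matr}$ and $\mathrm{matr}_\ast$ be the unions of these sets over all $n>0$ and $m,k\ge 0$. *Closed relations.* Let $\mathcal{M}$ be a class of monomorphisms, stable under pullbacks, in a finitely complete category $\mathbb{C}$. For $\mathrm{M}\in\mathrm{matr}(n,m,k)$, the category $\mathbb{C}$ *has $\mathrm{M}$-closed $\mathcal{M}$-relations* if for every $r\colon R\rightarrowtail X^n$ in $\mathcal{M}$, every object $Z$ and every function $f\colon\{x_1,\dots,x_k\}\to\mathbb{C}(Z,X)$ the following holds: if for each $j\in\{1,\dots,m\}$ the morphism $(f(x_{1j}),\dots,f(x_{nj}))\colon Z\to X^n$ factors through $r$, then so does $(f(x_{1\,m+1}),\dots,f(x_{n\,m+1}))$. If $\mathbb{C}$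 is moreover pointed (i.e. has a zero object) and $\mathrm{M}\in\mathrm{matr}_\ast(n,m,k)$, the definition is the same with the functions $f\colon\{\ast,x_1,\dots,x_k\}\to\mathbb{C}(Z,X)$ such that $f(\ast)=0$. For a set $S$ of matrices, $\mathbb{C}$ *has $S$-closed $\mathcal{M}$-relations* if it has $\mathrm{M}$-closed $\mathcal{M}$-relations for all $\mathrm{M}\in S$. *Partial algebras.* For $S\subseteq\mathrm{matr}$, an object of the category $\mathsf{Part}^S$ is a (possibly empty) set $A$ with, for each $\mathrm{M}\in S$ with $m$ left columns, a partial function $p^{\mathrm{M}}\colon A^m\dashrightarrow A$ such that, for each row $i$ of $\mathrm{M}$ and all values in $A$ of the variables $x_1,\dots,x_k$, $p^{\mathrm{M}}(x_{i1},\dots,x_{im})$ is defined and equal to $x_{i\,m+1}$. For $S\subseteq\mathrm{matr}_\ast$, an object of $\mathsf{Part}_\ast^S$ is defined in the same way with, in addition, a nullary operation $0$ which is required to be defined, the entry $\ast$ being interpreted as $0$. In both cases, a morphism $f\colon A\to B$ is a total function such that, for each operation symbol $\sigma$, whenever $\sigma^A(a_1,\dots,a_m)$ is defined, $\sigma^B(f(a_1),\dots,f(a_m))$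 is defined and equal to $f(\sigma^A(a_1,\dots,a_m))$. A *closed monomorphism* is a monomorphism $f\colon A\to B$ such that, for each operation symbol $\sigma$, if $\sigma^B(f(a_1),\dots,f(a_m))$ is defined, then $\sigma^A(a_1,\dots,a_m)$ is defined. Let $\mathrm{U}^S\colon\mathsf{Part}^S\to\mathsf{Set}$ be the forgetful functor to sets and $\mathrm{U}_\ast^S\colon\mathsf{Part}_\ast^S\to\mathsf{Set}_\ast$ the forgetful functor to pointed sets (with base point $0$). Let $\mathrm{Y}\colon\mathbb{C}\to\mathsf{Set}^{\mathbb{C}^{\mathrm{op}}}$ be the Yoneda embedding and, if $\mathbb{C}$ is pointed, let $\mathrm{Y}_\ast\colon\mathbb{C}\to\mathsf{Set}_\ast^{\mathbb{C}^{\mathrm{op}}}$ be the pointed Yoneda embedding, given by the hom-sets pointed by the zero morphisms. *Statement.* Let $S\subseteq\mathrm{matr}$ (respectively $S\subseteq\mathrm{matr}_\ast$), let $\mathbb{C}$ be a small finitely complete category (respectively a small finitely complete pointed category), and let $\mathcal{M}$ be a class of monomorphisms in $\mathbb{C}$ stable under pullbacks, closed under composition and containing the regular monomorphisms. If $\mathbb{C}$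 has $S$-closed $\mathcal{M}$-relations, then there exists a fully faithful functor $\varphi\colon\mathbb{C}\to(\mathsf{Part}^S)^{\mathbb{C}^{\mathrm{op}}}$ (respectively $\varphi\colon\mathbb{C}\to(\mathsf{Part}_\ast^S)^{\mathbb{C}^{\mathrm{op}}}$) such that 1. $\varphi$ preserves and reflects finite limits; 2. for every $f\in\mathcal{M}$ and every object $X$ of $\mathbb{C}$, the component $\varphi(f)_X$ is a closed monomorphism in $\mathsf{Part}^S$ (respectively in $\mathsf{Part}_\ast^S$); 3. $(\mathrm{U}^S)^{\mathbb{C}^{\mathrm{op}}}\circ\varphi=\mathrm{Y}$ (respectively $(\mathrm{U}_\ast^S)^{\mathbb{C}^{\mathrm{op}}}\circ\varphi=\mathrm{Y}_\ast$), where $(\mathrm{U}^S)^{\mathbb{C}^{\mathrm{op}}}$ and $(\mathrm{U}_\ast^S)^{\mathbb{C}^{\mathrm{op}}}$ denote post-composition with $\mathrm{U}^S$ and $\mathrm{U}_\ast^S$. -/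

import Mathlib

open CategoryTheory CategoryTheory.Limits

universe v u

namespace MatrixEmbedding

/-! ### Extended matrices -/

/-- An extended matrix with `n > 0` rows, `m` left columns and one right column. Its entries lie in
`V k`, the set of symbols available when there are `k` variables. -/
structure ExtMatrix (V : ℕ → Type) where
  n : ℕ
  m : ℕ
  k : ℕ
  n_pos : 0 < n
  left : Fin n → Fin m → V k
  right : Fin n → V k

/-- Non-pointed matrices: the entries lie in `{x₁, …, x_k}`. -/
abbrev Matr : Type := ExtMatrix Fin

/-- Pointed matrices: the entries lie in `{∗, x₁, …, x_k}`, where `none` is `∗`. -/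
abbrev MatrPt : Type := ExtMatrix (fun k => Option (Fin k))

/-! ### Closed relations -/

section Relations

variable {C : Type u} [Category.{v} C] [HasFiniteLimits C]

/-- The interpretation of `M` in the hom-set `Z ⟶ X` obtained by applying `f` to each entry is
compatible with `r : R ⟶ Xⁿ`: if the morphism `Z ⟶ Xⁿ` induced by each left column factors
through `r`, then so does the one induced by the right column. -/
def ExtMatrix.Compatible {V : ℕ → Type} (M : ExtMatrix V) {Z X R : C} (f : V M.k → (Z ⟶ X))
    (r : R ⟶ ∏ᶜ fun _ : Fin M.n => X) : Prop :=
  (∀ j : Fin M.m, ∃ t : Z ⟶ R, t ≫ r = Pi.lift fun i => f (M.left i j)) →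
    ∃ t : Z ⟶ R, t ≫ r = Pi.lift fun i => f (M.right i)

/-- The relation `r : R ⟶ Xⁿ` is `M`-closed, for a non-pointed matrix `M`. -/
def Matr.ClosedRel (M : Matr) {X R : C} (r : R ⟶ ∏ᶜ fun _ : Fin M.n => X) : Prop :=
  ∀ (Z : C) (f : Fin M.k → (Z ⟶ X)), M.Compatible f r

/-- The relation `r : R ⟶ Xⁿ` is `M`-closed, for a pointed matrix `M`: only the pointed functions
from `{∗, x₁, …, x_k}` to the hom-set `Z ⟶ X` are considered, its base point being `0`. -/
def MatrPt.ClosedRel [HasZeroMorphisms C] (M : MatrPt) {X R : C}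
    (r : R ⟶ ∏ᶜ fun _ : Fin M.n => X) : Prop :=
  ∀ (Z : C) (f : Option (Fin M.k) → (Z ⟶ X)), f none = 0 → M.Compatible f r

/-- `C` has `S`-closed `W`-relations, for a non-pointed matrix set `S`. -/
def HasClosedRelations (S : Set Matr) (W : MorphismProperty C) : Prop :=
  ∀ M ∈ S, ∀ ⦃X R : C⦄ (r : R ⟶ ∏ᶜ fun _ : Fin M.n => X), W r → Matr.ClosedRel M r

/-- `C` has `S`-closed `W`-relations, for a pointed category `C` and a matrix set `S`. -/
def HasClosedRelationsPt [HasZeroMorphisms C] (S : Set MatrPt) (W : MorphismProperty C) : Prop :=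
  ∀ M ∈ S, ∀ ⦃X R : C⦄ (r : R ⟶ ∏ᶜ fun _ : Fin M.n => X), W r → MatrPt.ClosedRel M r

end Relations

/-! ### Partial algebras -/

/-- A finitary one-sorted signature. -/
structure Signature where
  Op : Type
  arity : Op → ℕ

/-- Terms over the signature `sig` in the variables from `X`. -/
inductive Term (sig : Signature) (X : Type) : Type
  | var (x : X) : Term sig X
  | app (s : sig.Op) (t : Fin (sig.arity s) → Term sig X) : Term sig X

/-- A partial algebra: a (possibly empty) set with a partial operation for each symbol. -/
structure PartialAlgebra (sig : Signature) where
  carrier : Type v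
  op (s : sig.Op) : (Fin (sig.arity s) → carrier) →. carrier

/-- The partial function induced by a term: a composite term is defined exactly if all its
immediate subterms are and the operation is defined on their values. -/
def Term.eval {sig : Signature} {X : Type} (A : PartialAlgebra.{v} sig) (a : X → A.carrier) :
    Term sig X → Part A.carrier
  | .var x => Part.some (a x)
  | .app s t =>
    Part.bind ⟨∀ i, ((t i).eval A a).Dom, fun h i => ((t i).eval A a).get (h i)⟩ (A.op s)

/-- An existence equation `lhs =ᵉ rhs` in the variables from `X`. -/
structure ExistenceEquation (sig : Signature) where
  X : Type
  lhs : Term sig X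
  rhs : Term sig X

/-- `A` satisfies an existence equation: on every assignment of the variables both sides are
defined, and they are equal. -/
def PartialAlgebra.Satisfies {sig : Signature} (A : PartialAlgebra.{v} sig)
    (e : ExistenceEquation sig) : Prop :=
  ∀ a : e.X → A.carrier, ∃ b, b ∈ e.lhs.eval A a ∧ b ∈ e.rhs.eval A a

/-- The objects of the category `Part(sig, E)`: partial algebras satisfying the equations of `E`. -/
structure PartAlg (sig : Signature) (E : Set (ExistenceEquation sig)) extends
    PartialAlgebra.{v} sig where
  sat : ∀ e ∈ E, toPartialAlgebra.Satisfies e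

namespace PartAlg

variable {sig : Signature} {E : Set (ExistenceEquation sig)}

/-- A homomorphism: a total function such that, whenever an operation is defined with value `b` on
`a`, it is defined with value `f b` on `f ∘ a`. -/
@[ext]
structure Hom (A B : PartAlg.{v} sig E) where
  toFun : A.carrier → B.carrier
  map_op : ∀ (s : sig.Op) (a : Fin (sig.arity s) → A.carrier) (b : A.carrier),
    b ∈ A.op s a → toFun b ∈ B.op s (toFun ∘ a)

instance : Category.{v} (PartAlg.{v} sig E) where
  Hom := Hom
  id A := ⟨id, fun _ _ _ h => h⟩
  comp f g := ⟨g.toFun ∘ f.toFun, fun s a b h => g.map_op s _ _ (f.map_op s a b h)⟩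

/-- The underlying set functor. -/
def forget (sig : Signature) (E : Set (ExistenceEquation sig)) : PartAlg.{v} sig E ⥤ Type v where
  obj A := A.carrier
  map f := ↾f.toFun

/-- A closed monomorphism: a monomorphism `f` such that an operation is defined on `a` as soon as it
is defined on `f ∘ a`. -/
def IsClosedMono {A B : PartAlg.{v} sig E} (f : A ⟶ B) : Prop :=
  Mono f ∧ ∀ (s : sig.Op) (a : Fin (sig.arity s) → A.carrier),
    (B.op s (f.toFun ∘ a)).Dom → (A.op s a).Dom

end PartAlg

/-! ### Partial algebras of a matrix set: the non-pointed case -/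

/-- One symbol for each matrix of `S`, of arity its number of left columns. -/
abbrev sigOf (S : Set Matr) : Signature where
  Op := S
  arity M := M.1.m

/-- The existence equation `p(x_{i1}, …, x_{im}) =ᵉ x_{i,m+1}` of the `i`-th row of `M`. -/
def rowEquation (S : Set Matr) (M : S) (i : Fin M.1.n) : ExistenceEquation (sigOf S) where
  X := Fin M.1.k
  lhs := .app (sig := sigOf S) M fun j => .var (M.1.left i j)
  rhs := .var (M.1.right i)

/-- One existence equation for each row of each matrix of `S`. -/
def equationsOf (S : Set Matr) : Set (ExistenceEquation (sigOf S)) :=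
  {e | ∃ (M : S) (i : Fin M.1.n), e = rowEquation S M i}

/-- The category of partial algebras of a non-pointed matrix set. -/
abbrev PartS (S : Set Matr) : Type (v + 1) := PartAlg.{v} (sigOf S) (equationsOf S)

/-- The underlying set functor of the category of partial algebras of a matrix set. -/
abbrev forgetS (S : Set Matr) : PartS.{v} S ⥤ Type v := PartAlg.forget _ _

/-! ### Partial algebras of a matrix set: the pointed case -/

/-- A nullary symbol `none` (the constant `0`), and one symbol for each matrix of `S`, of arity its
number of left columns. -/
abbrev sigOfPt (S : Set MatrPt) : Signature where
  Op := Option S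
  arity s := s.elim 0 fun M => M.1.m

/-- The constant term `0`. -/
def zeroTerm (S : Set MatrPt) (X : Type) : Term (sigOfPt S) X :=
  .app (sig := sigOfPt S) none Fin.elim0

/-- The entry `∗` is read as the constant `0` and the other entries as variables. -/
def entryTerm (S : Set MatrPt) {k : ℕ} (x : Option (Fin k)) : Term (sigOfPt S) (Fin k) :=
  x.elim (zeroTerm S _) .var

/-- The existence equation `p(x_{i1}, …, x_{im}) =ᵉ x_{i,m+1}` of the `i`-th row of `M`. -/
def rowEquationPt (S : Set MatrPt) (M : S) (i : Fin M.1.n) : ExistenceEquation (sigOfPt S) where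
  X := Fin M.1.k
  lhs := .app (sig := sigOfPt S) (some M) fun j => entryTerm S (M.1.left i j)
  rhs := entryTerm S (M.1.right i)

/-- The existence equation `0 =ᵉ 0`, without variables: it says that `0` is defined. -/
def zeroEquation (S : Set MatrPt) : ExistenceEquation (sigOfPt S) where
  X := Empty
  lhs := zeroTerm S _
  rhs := zeroTerm S _

/-- The equation `0 =ᵉ 0`, and one existence equation for each row of each matrix of `S`. -/
def equationsOfPt (S : Set MatrPt) : Set (ExistenceEquation (sigOfPt S)) :=
  {e | e = zeroEquation S ∨ ∃ (M : S) (i : Fin M.1.n), e = rowEquationPt S M i}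

/-- The category of partial algebras of a matrix set, in the pointed case. -/
abbrev PartPtS (S : Set MatrPt) : Type (v + 1) := PartAlg.{v} (sigOfPt S) (equationsOfPt S)

theorem zero_dom {S : Set MatrPt} (A : PartPtS.{v} S) :
    (A.op (none : Option S) Fin.elim0).Dom := by
  obtain ⟨b, hb, -⟩ := A.sat (zeroEquation S) (Or.inl rfl) Empty.elim
  obtain ⟨h, -⟩ := hb
  obtain ⟨h₁, h₂⟩ := h
  have e : ∀ t : Fin 0 → A.carrier, (A.op (none : Option S) t).Dom →
      (A.op (none : Option S) Fin.elim0).Dom := fun t ht =>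
    (funext fun i => Fin.elim0 i : t = Fin.elim0) ▸ ht
  exact e _ h₂

/-- The value of the constant `0` in `A`. -/
def zeroOf {S : Set MatrPt} (A : PartPtS.{v} S) : A.carrier :=
  (A.op (none : Option S) Fin.elim0).get (zero_dom A)

theorem map_zeroOf {S : Set MatrPt} {A B : PartPtS.{v} S} (f : A ⟶ B) :
    f.toFun (zeroOf A) = zeroOf B := by
  have h := f.map_op (none : Option S) Fin.elim0 (zeroOf A) (Part.get_mem (zero_dom A))
  have e : f.toFun ∘ (Fin.elim0 : Fin 0 → A.carrier) = Fin.elim0 := funext fun i => Fin.elim0 i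
  have h' : f.toFun (zeroOf A) ∈ B.op (none : Option S) Fin.elim0 := e ▸ h
  exact Part.mem_unique h' (Part.get_mem (zero_dom B))

/-- The underlying pointed set functor: the base point is the value of `0`. -/
def forgetPtS (S : Set MatrPt) : PartPtS.{v} S ⥤ Pointed.{v} where
  obj A := ⟨A.carrier, zeroOf A⟩
  map f := ⟨f.toFun, map_zeroOf f⟩

/-- The pointed Yoneda embedding: each hom-set is pointed by the zero morphism. -/
def yonedaPt (C : Type u) [Category.{v} C] [HasZeroMorphisms C] : C ⥤ Cᵒᵖ ⥤ Pointed.{v} where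
  obj X :=
    { obj := fun Z => ⟨Z.unop ⟶ X, 0⟩
      map := fun g => ⟨fun h => g.unop ≫ h, comp_zero⟩
      map_id := fun _ => Pointed.Hom.ext (funext fun h => Category.id_comp h)
      map_comp := fun _ _ => Pointed.Hom.ext (funext fun h => Category.assoc _ _ h) }
  map f :=
    { app := fun _ => ⟨fun h => h ≫ f, zero_comp⟩
      naturality := fun _ _ _ => Pointed.Hom.ext (funext fun h => Category.assoc _ h f) }
  map_id _ := NatTrans.ext (funext fun _ =>
    Pointed.Hom.ext (funext fun h => Category.comp_id h))
  map_comp f g := NatTrans.ext (funext fun _ =>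
    Pointed.Hom.ext (funext fun h => (Category.assoc h f g).symm))

end MatrixEmbedding

open MatrixEmbedding

namespace MatrixEmbedding

/-! Each matrix M acts on the hom-sets `Z ⟶ Y` by a partial operation: p(a) = b when a and b are the
images, under some `h : R ⟶ Y`, of the left columns and of the right column of an interpretation of
M in some `Z ⟶ X`, where R is a relation on X in `W` containing these columns. This graph is natural
in Z and Y, and the full relation X^n with its projections gives the row equations (`Graph.row`).
The usual Yoneda argument then makes the hom-functor fully faithful.

The crux is `Graph.exists_common`. Given two such presentations over X₁ and X₂ whose arguments agree
in T, consider the relation on X₁ × X₂ where both relations hold and the two maps to T agree. It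
lies in `W` by stability under pullback and composition and because equalizers are regular
monomorphisms. It contains the left columns, so by M-closedness it contains the right one: the
results agree in T too. Taking T = Y shows that p is single-valued; gluing the two maps over a
cospan shows that pullbacks are preserved. Over a terminal object p is total, and pulling `h` back
along a member of `W` gives closed monomorphisms. -/

/-! ### Partial operations on hom-sets -/

/-- For each symbol of `sig`, a partial operation on the hom-sets of `C`, given by its graph, which
is natural in both variables. -/
structure HomOperations (sig : Signature) (C : Type u) [Category.{v} C] where
  rel (s : sig.Op) {Z Y : C} : (Fin (sig.arity s) → (Z ⟶ Y)) → (Z ⟶ Y) → Prop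
  functional (s : sig.Op) {Z Y : C} {a : Fin (sig.arity s) → (Z ⟶ Y)} {b b' : Z ⟶ Y} :
    rel s a b → rel s a b' → b = b'
  precomp (s : sig.Op) {Z' Z Y : C} (g : Z' ⟶ Z) {a : Fin (sig.arity s) → (Z ⟶ Y)} {b : Z ⟶ Y} :
    rel s a b → rel s (fun j => g ≫ a j) (g ≫ b)
  postcomp (s : sig.Op) {Z Y Y' : C} (g : Y ⟶ Y') {a : Fin (sig.arity s) → (Z ⟶ Y)} {b : Z ⟶ Y} :
    rel s a b → rel s (fun j => a j ≫ g) (b ≫ g)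

namespace HomOperations

variable {sig : Signature} {C : Type u} [Category.{v} C] (P : HomOperations sig C)

/-- The partial algebra with underlying set `Z ⟶ Y`. -/
noncomputable def algebra (Z Y : C) : PartialAlgebra.{v} sig where
  carrier := Z ⟶ Y
  op s a := ⟨∃ b, P.rel s a b, fun h => h.choose⟩

/-- By functionality, the value picked by choice is the only one. -/
theorem mem_op {Z Y : C} (s : sig.Op) (a : Fin (sig.arity s) → (Z ⟶ Y)) (b : Z ⟶ Y) :
    b ∈ (P.algebra Z Y).op s a ↔ P.rel s a b := by
  constructor
  · rintro ⟨h, rfl⟩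
    exact h.choose_spec
  · intro hb
    exact ⟨⟨b, hb⟩, P.functional s (Exists.choose_spec (⟨b, hb⟩ : ∃ b, P.rel s a b)) hb⟩

variable {E : Set (ExistenceEquation sig)}
  (sat : ∀ Z Y : C, ∀ e ∈ E, (P.algebra Z Y).Satisfies e)

/-- The hom-functor with values in partial algebras. -/
noncomputable def functor : C ⥤ Cᵒᵖ ⥤ PartAlg.{v} sig E where
  obj Y :=
    { obj := fun Z => ⟨P.algebra Z.unop Y, sat _ _⟩
      map := fun g => ⟨fun h => g.unop ≫ h, fun s a b hb =>
        (P.mem_op s _ _).2 (P.precomp s g.unop ((P.mem_op s a b).1 hb))⟩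
      map_id := fun _ => PartAlg.Hom.ext (funext fun h => Category.id_comp h)
      map_comp := fun _ _ => PartAlg.Hom.ext (funext fun h => Category.assoc _ _ h) }
  map f :=
    { app := fun _ => ⟨fun h => h ≫ f, fun s a b hb =>
        (P.mem_op s _ _).2 (P.postcomp s f ((P.mem_op s a b).1 hb))⟩
      naturality := fun _ _ _ => PartAlg.Hom.ext (funext fun h => Category.assoc _ h f) }
  map_id _ := NatTrans.ext (funext fun _ =>
    PartAlg.Hom.ext (funext fun h => Category.comp_id h))
  map_comp f g := NatTrans.ext (funext fun _ =>
    PartAlg.Hom.ext (funext fun h => (Category.assoc h f g).symm))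

theorem functor_faithful : (P.functor sat).Faithful where
  map_injective {X Y} f g h := by
    have := congrArg (fun α => (α.app (Opposite.op X)).toFun (𝟙 X)) h
    exact (Category.id_comp f).symm.trans (this.trans (Category.id_comp g))

/-- The Yoneda argument on underlying maps suffices, since a homomorphism is determined by its
underlying function. -/
theorem functor_full : (P.functor sat).Full where
  map_surjective {X Y} α := by
    refine ⟨(α.app (Opposite.op X)).toFun (𝟙 X), NatTrans.ext (funext fun Z =>
      PartAlg.Hom.ext (funext fun (h : Z.unop ⟶ X) => ?_))⟩
    have := congrArg (fun β => β.toFun (𝟙 X)) (α.naturality h.op)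
    refine Eq.trans (Eq.symm this) ?_
    exact congrArg (α.app Z).toFun (Category.comp_id h)

/-- The hom-functor preserves limits of a given shape as soon as their cones jointly reflect the
operations. -/
theorem preservesLimitsOfShape {J : Type} [SmallCategory J]
    (hJ : ∀ (F : J ⥤ C) (c : Cone F), IsLimit c → ∀ (s : sig.Op) (Z : C)
      (a : Fin (sig.arity s) → (Z ⟶ c.pt)) (b : Z ⟶ c.pt),
      (∀ j, P.rel s (fun i => a i ≫ c.π.app j) (b ≫ c.π.app j)) → P.rel s a b) :
    PreservesLimitsOfShape J (P.functor sat) where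
  preservesLimit {F} := ⟨fun {c} hc => ⟨evaluationJointlyReflectsLimits _ fun Z => by
    let G := P.functor sat ⋙ (evaluation _ _).obj Z
    -- An element of the apex of a cone of partial algebras is a cone over `F` with vertex `Z.unop`.
    -- This forces the underlying map of the lift; `hJ` is what makes it a homomorphism.
    let toCone (s : Cone (F ⋙ G)) (x : s.pt.carrier) : Cone F :=
      { pt := Z.unop
        π :=
          { app := fun j => (s.π.app j).toFun x
            naturality := fun i j g => by
              have := congrArg (fun β => β.toFun x) (s.w g)
              exact (Category.id_comp _).trans (Eq.symm this) } }
    have fac (s : Cone (F ⋙ G)) (x : s.pt.carrier) (j : J) :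
        hc.lift (toCone s x) ≫ c.π.app j = (s.π.app j).toFun x := hc.fac (toCone s x) j
    exact
      { lift := fun s => ⟨fun x => hc.lift (toCone s x), fun t a b hb => by
          refine (P.mem_op t _ _).2 (hJ F c hc t _ _ _ fun j => ?_)
          have := (P.mem_op t _ _).1 ((s.π.app j).map_op t a b hb)
          have e : (fun i => hc.lift (toCone s (a i)) ≫ c.π.app j) = (s.π.app j).toFun ∘ a :=
            funext fun i => fac s (a i) j
          exact (congrArg₂ (P.rel t) e (fac s b j)).mpr this⟩
        fac := fun s j => PartAlg.Hom.ext (funext fun x => fac s x j)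
        uniq := fun s m hm => PartAlg.Hom.ext (funext fun x =>
          hc.hom_ext fun j => (congrArg (fun β => β.toFun x) (hm j)).trans (fac s x j).symm) }⟩⟩

theorem isClosedMono_functor_map {A B : C} (f : A ⟶ B) [Mono f]
    (hf : ∀ (s : sig.Op) (Z : C) (a : Fin (sig.arity s) → (Z ⟶ A)) (b : Z ⟶ B),
      P.rel s (fun j => a j ≫ f) b → ∃ b', P.rel s a b') (X : C) :
    PartAlg.IsClosedMono (((P.functor sat).map f).app (Opposite.op X)) := by
  refine ⟨⟨fun g h e => PartAlg.Hom.ext (funext fun x => ?_)⟩, fun s a h => ?_⟩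
  · exact (cancel_mono f).1 (congrArg (fun β => β.toFun x) e)
  · exact hf s X a h.choose h.choose_spec

/-- The properties of a family of operations that make the hom-functor an embedding in the sense of
the main theorem. -/
structure IsClosedFor (W : MorphismProperty C) : Prop where
  pullback (s : sig.Op) {Z Q Y Y' T : C} {p : Q ⟶ Y} {q : Q ⟶ Y'} {u : Y ⟶ T} {u' : Y' ⟶ T} :
    IsPullback p q u u' → ∀ (a : Fin (sig.arity s) → (Z ⟶ Q)) (b : Z ⟶ Q),
      P.rel s (fun j => a j ≫ p) (b ≫ p) → P.rel s (fun j => a j ≫ q) (b ≫ q) → P.rel s a b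
  terminal (s : sig.Op) {Z T : C} : IsTerminal T →
    ∀ (a : Fin (sig.arity s) → (Z ⟶ T)) (b : Z ⟶ T), P.rel s a b
  closed (s : sig.Op) {Z A B : C} (f : A ⟶ B) : W f →
    ∀ (a : Fin (sig.arity s) → (Z ⟶ A)) (b : Z ⟶ B),
      P.rel s (fun j => a j ≫ f) b → ∃ b', P.rel s a b'

variable {P} {W : MorphismProperty C}

theorem IsClosedFor.preservesFiniteLimits [HasFiniteLimits C] (h : P.IsClosedFor W) :
    PreservesFiniteLimits (P.functor sat) := by
  have : PreservesLimitsOfShape (Discrete PEmpty.{1}) (P.functor sat) :=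
    -- For the empty shape the assumption of `hJ` is vacuous, so the operations on morphisms into a
    -- terminal object must be total and hold of every pair.
    P.preservesLimitsOfShape sat fun F c hc s Z a b _ =>
      h.terminal s (T := c.pt) (IsTerminal.ofUniqueHom
        (fun X => hc.lift ⟨X, Discrete.natTrans fun j => j.as.elim⟩)
        (fun X m => hc.hom_ext fun j => j.as.elim)) a b
  have : PreservesLimitsOfShape WalkingCospan (P.functor sat) :=
    P.preservesLimitsOfShape sat fun F c hc s Z a b hab =>
      h.pullback s (IsPullback.of_isLimit_cone hc) a b (hab _) (hab _)
  exact preservesFiniteLimits_of_preservesTerminal_and_pullbacks _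

end HomOperations

/-! ### The partial operation of an extended matrix -/

section MatrixRelation

variable {V : ℕ → Type} {C : Type u} [Category.{v} C] [HasFiniteLimits C]

/-- The graph of the partial operation of `M` on the hom-sets of `C`: the images of the columns of
an interpretation of `M` under a morphism `h : R ⟶ Y` defined on a relation `R` in `W` which
contains these columns. Only the interpretations satisfying `adm` are considered. -/
def ExtMatrix.Graph (M : ExtMatrix V) (W : MorphismProperty C)
    (adm : ∀ ⦃Z X : C⦄, (V M.k → (Z ⟶ X)) → Prop) {Z Y : C} (a : Fin M.m → (Z ⟶ Y))
    (b : Z ⟶ Y) : Prop :=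
  ∃ (X R : C) (f : V M.k → (Z ⟶ X)) (r : R ⟶ ∏ᶜ fun _ : Fin M.n => X) (h : R ⟶ Y)
    (t : Fin M.m → (Z ⟶ R)) (t' : Z ⟶ R), adm f ∧ W r ∧
    (∀ j, t j ≫ r = Pi.lift fun i => f (M.left i j)) ∧ (t' ≫ r = Pi.lift fun i => f (M.right i)) ∧
    (∀ j, t j ≫ h = a j) ∧ t' ≫ h = b

/-- The interpretations satisfying `adm` are stable under precomposition and pairing, and the
relations in `W` are compatible with them. -/
structure ExtMatrix.IsAdmissible (M : ExtMatrix V) (W : MorphismProperty C)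
    (adm : ∀ ⦃Z X : C⦄, (V M.k → (Z ⟶ X)) → Prop) : Prop where
  precomp {Z' Z X : C} (g : Z' ⟶ Z) {f : V M.k → (Z ⟶ X)} : adm f → adm fun x => g ≫ f x
  lift {Z X X' : C} {f : V M.k → (Z ⟶ X)} {f' : V M.k → (Z ⟶ X')} : adm f → adm f' →
    adm fun x => prod.lift (f x) (f' x)
  exists_adm (Z : C) : ∃ f : V M.k → (Z ⟶ ⊤_ C), adm f
  compatible {Z X R : C} {f : V M.k → (Z ⟶ X)} (r : R ⟶ ∏ᶜ fun _ : Fin M.n => X) : W r → adm f →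
    M.Compatible f r

namespace ExtMatrix

variable {M : ExtMatrix V} {W : MorphismProperty C} {adm : ∀ ⦃Z X : C⦄, (V M.k → (Z ⟶ X)) → Prop}

theorem Graph.precomp (hM : M.IsAdmissible W adm) {Z' Z Y : C} (g : Z' ⟶ Z)
    {a : Fin M.m → (Z ⟶ Y)} {b : Z ⟶ Y} (hab : M.Graph W adm a b) :
    M.Graph W adm (fun j => g ≫ a j) (g ≫ b) := by
  obtain ⟨X, R, f, r, h, t, t', hf, hr, ht, ht', ha, hb⟩ := hab
  refine ⟨X, R, fun x => g ≫ f x, r, h, fun j => g ≫ t j, g ≫ t', hM.precomp g hf, hr,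
    fun j => ?_, ?_, fun j => ?_, ?_⟩
  · rw [Category.assoc, ht]
    ext; simp
  · rw [Category.assoc, ht']
    ext; simp
  · rw [Category.assoc, ha]
  · rw [Category.assoc, hb]

theorem Graph.postcomp {Z Y Y' : C} (g : Y ⟶ Y') {a : Fin M.m → (Z ⟶ Y)} {b : Z ⟶ Y}
    (hab : M.Graph W adm a b) : M.Graph W adm (fun j => a j ≫ g) (b ≫ g) := by
  obtain ⟨X, R, f, r, h, t, t', hf, hr, ht, ht', ha, hb⟩ := hab
  exact ⟨X, R, f, r, h ≫ g, t, t', hf, hr, ht, ht', fun j => by simp [← ha], by simp [← hb]⟩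

/-- The graph contains the rows of all interpretations. -/
theorem Graph.row (hid : W.ContainsIdentities) {Z X : C} {f : V M.k → (Z ⟶ X)} (hf : adm f)
    (i : Fin M.n) : M.Graph W adm (fun j => f (M.left i j)) (f (M.right i)) :=
  -- On the full relation X^n, the i-th projection sends each column to its i-th entry.
  ⟨X, _, f, 𝟙 _, Pi.π _ i, fun j => Pi.lift fun i => f (M.left i j),
    Pi.lift fun i => f (M.right i), hf, hid.id_mem _, fun _ => Category.comp_id _,
    Category.comp_id _, fun _ => by simp, by simp⟩

theorem Graph.terminal (hM : M.IsAdmissible W adm) (hid : W.ContainsIdentities) {Z T : C}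
    (hT : IsTerminal T) (a : Fin M.m → (Z ⟶ T)) (b : Z ⟶ T) : M.Graph W adm a b := by
  obtain ⟨f, hf⟩ := hM.exists_adm Z
  exact ⟨⊤_ C, _, f, 𝟙 _, hT.from _, fun j => Pi.lift fun i => f (M.left i j),
    Pi.lift fun i => f (M.right i), hf, hid.id_mem _, fun _ => Category.comp_id _,
    Category.comp_id _, fun _ => hT.hom_ext _ _, hT.hom_ext _ _⟩

/-- The pullback of `h` along `g` is a smaller relation on X, still in `W`. It contains the left
columns because their images lift along `g`, hence it contains the right column, whose image in `A`
is the required value. -/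
theorem Graph.closed (hM : M.IsAdmissible W adm) (hbase : W.IsStableUnderBaseChange)
    (hcomp : W.IsStableUnderComposition) {Z A B : C}
    (g : A ⟶ B) (hg : W g) (a : Fin M.m → (Z ⟶ A)) (b : Z ⟶ B)
    (hab : M.Graph W adm (fun j => a j ≫ g) b) : ∃ b', M.Graph W adm a b' := by
  obtain ⟨X, R, f, r, h, t, t', hf, hr, ht, ht', ha, hb⟩ := hab
  have hr' : W (pullback.fst h g ≫ r) := W.comp_mem _ _ (W.pullback_fst _ _ hg) hr
  let l (j : Fin M.m) : Z ⟶ pullback h g := pullback.lift (t j) (a j) (ha j)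
  have hl (j : Fin M.m) : l j ≫ pullback.fst h g ≫ r = Pi.lift fun i => f (M.left i j) := by
    simp only [l, pullback.lift_fst_assoc, ht]
  obtain ⟨l', hl'⟩ := hM.compatible _ hr' hf fun j => ⟨l j, hl j⟩
  exact ⟨l' ≫ pullback.snd h g, X, _, f, _, pullback.snd h g, l, l', hf, hr', hl, hl',
    fun j => pullback.lift_snd _ _ _, rfl⟩

/-- Two elements of graphs whose arguments agree in `T` come from a common interpretation. -/
theorem Graph.exists_common (hM : M.IsAdmissible W adm)
    (hmono : W ≤ MorphismProperty.monomorphisms C)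
    (hbase : W.IsStableUnderBaseChange) (hcomp : W.IsStableUnderComposition)
    (hreg : MorphismProperty.regularMono C ≤ W) {Z Y Y' T : C} (u : Y ⟶ T) (u' : Y' ⟶ T)
    {a : Fin M.m → (Z ⟶ Y)} {b : Z ⟶ Y} {a' : Fin M.m → (Z ⟶ Y')} {b' : Z ⟶ Y'}
    (hab : M.Graph W adm a b) (hab' : M.Graph W adm a' b') (haa' : ∀ j, a j ≫ u = a' j ≫ u') :
    ∃ (X R : C) (f : V M.k → (Z ⟶ X)) (r : R ⟶ ∏ᶜ fun _ : Fin M.n => X) (h : R ⟶ Y) (h' : R ⟶ Y')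
      (t : Fin M.m → (Z ⟶ R)) (t' : Z ⟶ R), adm f ∧ W r ∧
      (∀ j, t j ≫ r = Pi.lift fun i => f (M.left i j)) ∧
      (t' ≫ r = Pi.lift fun i => f (M.right i)) ∧
      (∀ j, t j ≫ h = a j) ∧ (∀ j, t j ≫ h' = a' j) ∧ t' ≫ h = b ∧ t' ≫ h' = b' ∧
      h ≫ u = h' ≫ u' := by
  obtain ⟨X₁, R₁, f₁, r₁, h₁, t₁, t₁', hf₁, hr₁, ht₁, ht₁', ha₁, hb₁⟩ := hab
  obtain ⟨X₂, R₂, f₂, r₂, h₂, t₂, t₂', hf₂, hr₂, ht₂, ht₂', ha₂, hb₂⟩ := hab'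
  let f : V M.k → (Z ⟶ X₁ ⨯ X₂) := fun x => prod.lift (f₁ x) (f₂ x)
  let q₁ : (∏ᶜ fun _ : Fin M.n => X₁ ⨯ X₂) ⟶ ∏ᶜ fun _ : Fin M.n => X₁ :=
    Limits.Pi.map fun _ => prod.fst
  let q₂ : (∏ᶜ fun _ : Fin M.n => X₁ ⨯ X₂) ⟶ ∏ᶜ fun _ : Fin M.n => X₂ :=
    Limits.Pi.map fun _ => prod.snd
  have hq₁ (y : Fin M.n → V M.k) :
      (Pi.lift fun i => f (y i)) ≫ q₁ = Pi.lift fun i => f₁ (y i) := by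
    ext i
    simpa [q₁] using prod.lift_fst _ _
  have hq₂ (y : Fin M.n → V M.k) :
      (Pi.lift fun i => f (y i)) ≫ q₂ = Pi.lift fun i => f₂ (y i) := by
    ext i
    simpa [q₂] using prod.lift_snd _ _
  obtain ⟨P₁, s₁, e₁, sq₁⟩ : ∃ P₁ s₁ e₁, IsPullback (P := P₁) s₁ e₁ q₁ r₁ :=
    ⟨_, _, _, IsPullback.of_hasPullback q₁ r₁⟩
  obtain ⟨P₂, s₂, e₂, sq₂⟩ : ∃ P₂ s₂ e₂, IsPullback (P := P₂) s₂ e₂ q₂ r₂ :=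
    ⟨_, _, _, IsPullback.of_hasPullback q₂ r₂⟩
  obtain ⟨D, d₁, d₂, sq⟩ : ∃ D d₁ d₂, IsPullback (P := D) d₁ d₂ s₁ s₂ :=
    ⟨_, _, _, IsPullback.of_hasPullback s₁ s₂⟩
  -- `D` is the intersection of the preimages of `r₁` and `r₂` in (X₁ × X₂)^n; `d` cuts out the part
  -- where the two maps to `T` agree.
  let d := equalizer.ι (d₁ ≫ e₁ ≫ h₁ ≫ u) (d₂ ≫ e₂ ≫ h₂ ≫ u')
  let r := d ≫ d₁ ≫ s₁
  have hr : W r :=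
    W.comp_mem _ _ (hreg _ ((MorphismProperty.regularMono_iff d).2 inferInstance))
      (W.comp_mem _ _ (W.of_isPullback sq.flip (W.of_isPullback sq₂.flip hr₂))
        (W.of_isPullback sq₁.flip hr₁))
  have hre : r ≫ q₁ = d ≫ d₁ ≫ e₁ ≫ r₁ := by
    simp only [r, Category.assoc, sq₁.w]
  have hre' : r ≫ q₂ = d ≫ d₂ ≫ e₂ ≫ r₂ := by
    simp only [r, Category.assoc, sq.w_assoc, sq₂.w]
  have hm₁ : Mono r₁ := hmono _ hr₁
  have hm₂ : Mono r₂ := hmono _ hr₂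
  have key (y : Fin M.n → V M.k) (x₁ : Z ⟶ R₁) (x₂ : Z ⟶ R₂)
      (hx₁ : x₁ ≫ r₁ = Pi.lift fun i => f₁ (y i)) (hx₂ : x₂ ≫ r₂ = Pi.lift fun i => f₂ (y i))
      (hx : x₁ ≫ h₁ ≫ u = x₂ ≫ h₂ ≫ u') : ∃ x, x ≫ r = Pi.lift fun i => f (y i) := by
    refine ⟨equalizer.lift (sq.lift (sq₁.lift (Pi.lift fun i => f (y i)) x₁ ?_)
      (sq₂.lift (Pi.lift fun i => f (y i)) x₂ ?_) ?_) ?_, ?_⟩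
    · rw [hq₁, hx₁]
    · rw [hq₂, hx₂]
    · simp
    · simpa using hx
    · simp [r, d]
  -- Since `r₁` and `r₂` are monomorphisms, a factorization through `r` induces the given
  -- factorizations through them.
  have uniq (y : Fin M.n → V M.k) (x : Z ⟶ equalizer (d₁ ≫ e₁ ≫ h₁ ≫ u) (d₂ ≫ e₂ ≫ h₂ ≫ u')) (x₁ : Z ⟶ R₁)
      (x₂ : Z ⟶ R₂) (hx₁ : x₁ ≫ r₁ = Pi.lift fun i => f₁ (y i))
      (hx₂ : x₂ ≫ r₂ = Pi.lift fun i => f₂ (y i)) (hx : x ≫ r = Pi.lift fun i => f (y i)) :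
      x ≫ d ≫ d₁ ≫ e₁ = x₁ ∧ x ≫ d ≫ d₂ ≫ e₂ = x₂ := by
    constructor
    · rw [← cancel_mono r₁, hx₁, ← hq₁, ← hx]
      simp only [Category.assoc, hre]
    · rw [← cancel_mono r₂, hx₂, ← hq₂, ← hx]
      simp only [Category.assoc, hre']
  have hkey (j : Fin M.m) : ∃ x, x ≫ r = Pi.lift fun i => f (M.left i j) :=
    key _ (t₁ j) (t₂ j) (ht₁ j) (ht₂ j) (by
      rw [reassoc_of% ha₁ j, reassoc_of% ha₂ j, haa'])
  choose t ht using hkey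
  -- Closedness enters here: agreement in `T` is known only for the left columns.
  obtain ⟨t', ht'⟩ := hM.compatible r hr (hM.lift hf₁ hf₂) fun j => ⟨t j, ht j⟩
  have hu (j : Fin M.m) := uniq _ _ _ _ (ht₁ j) (ht₂ j) (ht j)
  have hu' := uniq _ _ _ _ ht₁' ht₂' ht'
  refine ⟨_, _, f, r, d ≫ d₁ ≫ e₁ ≫ h₁, d ≫ d₂ ≫ e₂ ≫ h₂, t, t', hM.lift hf₁ hf₂, hr, ht, ht', fun j => ?_,
    fun j => ?_, ?_, ?_, ?_⟩
  · simpa [← (hu j).1] using ha₁ j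
  · simpa [← (hu j).2] using ha₂ j
  · simpa [← hu'.1] using hb₁
  · simpa [← hu'.2] using hb₂
  · simpa [d] using equalizer.condition (d₁ ≫ e₁ ≫ h₁ ≫ u) (d₂ ≫ e₂ ≫ h₂ ≫ u')

theorem Graph.functional (hM : M.IsAdmissible W adm)
    (hmono : W ≤ MorphismProperty.monomorphisms C)
    (hbase : W.IsStableUnderBaseChange) (hcomp : W.IsStableUnderComposition)
    (hreg : MorphismProperty.regularMono C ≤ W) {Z Y : C} {a : Fin M.m → (Z ⟶ Y)} {b b' : Z ⟶ Y}
    (hab : M.Graph W adm a b) (hab' : M.Graph W adm a b') : b = b' := by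
  obtain ⟨X, R, f, r, h, h', t, t', -, -, -, -, -, -, rfl, rfl, e⟩ :=
    hab.exists_common hM hmono hbase hcomp hreg (𝟙 Y) (𝟙 Y) hab' fun _ => rfl
  rw [Category.comp_id, Category.comp_id] at e
  rw [e]

/-- On the common relation the maps to `Y` and `Y'` agree in `T`, so they glue to a map into `Q`. -/
theorem Graph.pullback (hM : M.IsAdmissible W adm)
    (hmono : W ≤ MorphismProperty.monomorphisms C)
    (hbase : W.IsStableUnderBaseChange) (hcomp : W.IsStableUnderComposition)
    (hreg : MorphismProperty.regularMono C ≤ W) {Z Q Y Y' T : C} {p : Q ⟶ Y} {q : Q ⟶ Y'}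
    {u : Y ⟶ T} {u' : Y' ⟶ T} (sq : IsPullback p q u u') (a : Fin M.m → (Z ⟶ Q)) (b : Z ⟶ Q)
    (hab : M.Graph W adm (fun j => a j ≫ p) (b ≫ p))
    (hab' : M.Graph W adm (fun j => a j ≫ q) (b ≫ q)) : M.Graph W adm a b := by
  obtain ⟨X, R, f, r, h, h', t, t', hf, hr, ht, ht', ha, ha', hb, hb', e⟩ :=
    hab.exists_common hM hmono hbase hcomp hreg u u' hab' fun j => by
      simp only [Category.assoc, sq.w]
  refine ⟨X, R, f, r, sq.lift h h' e, t, t', hf, hr, ht, ht', fun j => ?_, ?_⟩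
  · apply sq.hom_ext <;> simp [ha, ha']
  · apply sq.hom_ext <;> simp [hb, hb']

end ExtMatrix

end MatrixRelation

theorem containsIdentities_of_regularMono_le {C : Type u} [Category.{v} C]
    {W : MorphismProperty C} (hreg : MorphismProperty.regularMono C ≤ W) :
    W.ContainsIdentities :=
  ⟨fun X => hreg _ ((MorphismProperty.regularMono C).id_mem X)⟩

section YonedaPointedBy

variable {C : Type u} [Category.{v} C]

/-- The Yoneda embedding with hom-sets pointed by a natural family of morphisms. -/
def yonedaPointedBy (z : ∀ (Z : Cᵒᵖ) (X : C), Z.unop ⟶ X)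
    (pre : ∀ {Z Z' : Cᵒᵖ} (g : Z ⟶ Z') (X : C), g.unop ≫ z Z X = z Z' X)
    (post : ∀ (Z : Cᵒᵖ) {X X' : C} (f : X ⟶ X'), z Z X ≫ f = z Z X') :
    C ⥤ Cᵒᵖ ⥤ Pointed.{v} where
  obj X :=
    { obj := fun Z => ⟨Z.unop ⟶ X, z Z X⟩
      map := fun g => ⟨fun h => g.unop ≫ h, pre g X⟩
      map_id := fun _ => Pointed.Hom.ext (funext fun h => Category.id_comp h)
      map_comp := fun _ _ => Pointed.Hom.ext (funext fun h => Category.assoc _ _ h) }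
  map f :=
    { app := fun Z => ⟨fun h => h ≫ f, post Z f⟩
      naturality := fun _ _ _ => Pointed.Hom.ext (funext fun h => Category.assoc _ h f) }
  map_id _ := NatTrans.ext (funext fun _ =>
    Pointed.Hom.ext (funext fun h => Category.comp_id h))
  map_comp f g := NatTrans.ext (funext fun _ =>
    Pointed.Hom.ext (funext fun h => (Category.assoc h f g).symm))

/-- The base points produced by the constant `0` equal the zero morphisms only propositionally.
Keeping them as a variable `z` lets the equality of functors follow by substitution. -/
theorem yonedaPointedBy_eq (z : ∀ (Z : Cᵒᵖ) (X : C), Z.unop ⟶ X)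
    (pre : ∀ {Z Z' : Cᵒᵖ} (g : Z ⟶ Z') (X : C), g.unop ≫ z Z X = z Z' X)
    (post : ∀ (Z : Cᵒᵖ) {X X' : C} (f : X ⟶ X'), z Z X ≫ f = z Z X')
    [HasZeroMorphisms C] (hz : ∀ Z X, z Z X = 0) : yonedaPointedBy z pre post = yonedaPt C := by
  obtain rfl : z = fun _ _ => 0 := funext fun Z => funext fun X => hz Z X
  rfl

end YonedaPointedBy

end MatrixEmbedding

/-! ### The non-pointed case: every interpretation is admissible. -/

section NonPointed

namespace MatrixEmbedding

variable {S : Set Matr} {C : Type u} [Category.{v} C] [HasFiniteLimits C]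
  {W : MorphismProperty C}

theorem HasClosedRelations.isAdmissible (hS : HasClosedRelations S W) (M : S) :
    M.1.IsAdmissible W (fun _ _ _ => True) where
  precomp _ _ _ := trivial
  lift _ _ := trivial
  exists_adm Z := ⟨fun _ => terminal.from Z, trivial⟩
  compatible r hr _ := hS M.1 M.2 r hr _ _

/-- The partial operations of the matrices of `S` on the hom-sets of `C`. -/
def homOperations (hmono : W ≤ MorphismProperty.monomorphisms C)
    (hbase : W.IsStableUnderBaseChange) (hcomp : W.IsStableUnderComposition)
    (hreg : MorphismProperty.regularMono C ≤ W) (hS : HasClosedRelations S W) :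
    HomOperations (sigOf S) C where
  rel M := M.1.Graph W fun _ _ _ => True
  functional M := ExtMatrix.Graph.functional (hS.isAdmissible M) hmono hbase hcomp hreg
  precomp M := ExtMatrix.Graph.precomp (hS.isAdmissible M)
  postcomp _ := ExtMatrix.Graph.postcomp

variable (hmono : W ≤ MorphismProperty.monomorphisms C)
    (hbase : W.IsStableUnderBaseChange) (hcomp : W.IsStableUnderComposition)
    (hreg : MorphismProperty.regularMono C ≤ W) (hS : HasClosedRelations S W)

theorem homOperations_isClosedFor :
    (homOperations hmono hbase hcomp hreg hS).IsClosedFor W where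
  pullback M := ExtMatrix.Graph.pullback (hS.isAdmissible M) hmono hbase hcomp hreg
  terminal M := ExtMatrix.Graph.terminal (hS.isAdmissible M)
    (containsIdentities_of_regularMono_le hreg)
  closed M := ExtMatrix.Graph.closed (hS.isAdmissible M) hbase hcomp

theorem homOperations_satisfies (Z Y : C) (e : ExistenceEquation (sigOf S))
    (he : e ∈ equationsOf S) :
    ((homOperations hmono hbase hcomp hreg hS).algebra Z Y).Satisfies e := by
  obtain ⟨M, i, rfl⟩ := he
  intro (a : Fin M.1.k → (Z ⟶ Y))
  refine ⟨a (M.1.right i), Part.mem_bind ⟨fun _ => trivial, rfl⟩ ?_, Part.mem_some _⟩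
  exact (HomOperations.mem_op _ _ _ _).2 (ExtMatrix.Graph.row (M := M.1)
    (adm := fun _ _ _ => True) (f := a) (containsIdentities_of_regularMono_le hreg) trivial i)

end MatrixEmbedding

end NonPointed

/-! ### The pointed case: admissible interpretations send ∗ to 0. -/

section Pointed

namespace MatrixEmbedding

variable {S : Set MatrPt} {C : Type u} [Category.{v} C] [HasFiniteLimits C]
  [HasZeroMorphisms C] {W : MorphismProperty C}

theorem HasClosedRelationsPt.isAdmissible (hS : HasClosedRelationsPt S W) (M : S) :
    M.1.IsAdmissible W (fun _ _ f => f none = 0) where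
  precomp g f hf := by simp [hf]
  lift hf hf' := by
    beta_reduce
    rw [hf, hf']
    ext
    · exact (prod.lift_fst _ _).trans zero_comp.symm
    · exact (prod.lift_snd _ _).trans zero_comp.symm
  exists_adm Z := ⟨fun _ => 0, rfl⟩
  compatible r hr hf := hS M.1 M.2 r hr _ _ hf

/-- The constant `0` and the partial operations of the matrices of `S` on the hom-sets of `C`. -/
def homOperationsPt (hmono : W ≤ MorphismProperty.monomorphisms C)
    (hbase : W.IsStableUnderBaseChange) (hcomp : W.IsStableUnderComposition)
    (hreg : MorphismProperty.regularMono C ≤ W) (hS : HasClosedRelationsPt S W) :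
    HomOperations (sigOfPt S) C where
  rel
    | none => fun _ b => b = 0
    | some M => M.1.Graph W fun _ _ f => f none = 0
  functional
    | none => fun h h' => h.trans h'.symm
    | some M => ExtMatrix.Graph.functional (hS.isAdmissible M) hmono hbase hcomp hreg
  precomp
    | none => fun g a b h => by subst h; exact comp_zero
    | some M => ExtMatrix.Graph.precomp (hS.isAdmissible M)
  postcomp
    | none => fun g a b h => by subst h; exact zero_comp
    | some _ => ExtMatrix.Graph.postcomp

variable (hmono : W ≤ MorphismProperty.monomorphisms C)
    (hbase : W.IsStableUnderBaseChange) (hcomp : W.IsStableUnderComposition)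
    (hreg : MorphismProperty.regularMono C ≤ W) (hS : HasClosedRelationsPt S W)

theorem homOperationsPt_isClosedFor :
    (homOperationsPt hmono hbase hcomp hreg hS).IsClosedFor W where
  pullback
    | none => fun sq a b (h : _ = 0) (h' : _ = 0) => sq.hom_ext (by simp [h]) (by simp [h'])
    | some M => ExtMatrix.Graph.pullback (hS.isAdmissible M) hmono hbase hcomp hreg
  terminal
    | none => fun hT _ _ => hT.hom_ext _ _
    | some M => ExtMatrix.Graph.terminal (hS.isAdmissible M)
        (containsIdentities_of_regularMono_le hreg)
  closed
    | none => fun _ _ _ _ _ => ⟨0, rfl⟩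
    | some M => ExtMatrix.Graph.closed (hS.isAdmissible M) hbase hcomp

theorem zero_mem_eval_zeroTerm {X : Type} {Z Y : C} (a : X → (Z ⟶ Y)) :
    (0 : Z ⟶ Y) ∈ (zeroTerm S X).eval
      ((homOperationsPt hmono hbase hcomp hreg hS).algebra Z Y) a :=
  Part.mem_bind ⟨fun i => i.elim0, rfl⟩ ((HomOperations.mem_op _ _ _ _).2 rfl)

theorem mem_eval_entryTerm {k : ℕ} {Z Y : C} (a : Fin k → (Z ⟶ Y)) (x : Option (Fin k)) :
    (x.elim 0 a : Z ⟶ Y) ∈ (entryTerm S x).eval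
      ((homOperationsPt hmono hbase hcomp hreg hS).algebra Z Y) a := by
  cases x with
  | none => exact zero_mem_eval_zeroTerm hmono hbase hcomp hreg hS a
  | some x => exact Part.mem_some _

theorem homOperationsPt_satisfies (Z Y : C) (e : ExistenceEquation (sigOfPt S))
    (he : e ∈ equationsOfPt S) :
    ((homOperationsPt hmono hbase hcomp hreg hS).algebra Z Y).Satisfies e := by
  obtain rfl | ⟨M, i, rfl⟩ := he
  · intro a
    exact ⟨(0 : Z ⟶ Y), zero_mem_eval_zeroTerm hmono hbase hcomp hreg hS a,
      zero_mem_eval_zeroTerm hmono hbase hcomp hreg hS a⟩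
  · intro (a : Fin M.1.k → (Z ⟶ Y))
    have key := mem_eval_entryTerm hmono hbase hcomp hreg hS a
    refine ⟨((M.1.right i).elim 0 a : Z ⟶ Y), Part.mem_bind
      ⟨fun j => (key (M.1.left i j)).1, rfl⟩ ?_, key _⟩
    -- The arguments produced by term evaluation are identified with the interpreted entries, ∗
    -- being read as 0.
    have e : (fun j => ((entryTerm S (M.1.left i j)).eval
        ((homOperationsPt hmono hbase hcomp hreg hS).algebra Z Y) a).get (key (M.1.left i j)).1) =
        fun j => ((M.1.left i j).elim 0 a : Z ⟶ Y) :=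
      funext fun j => (key (M.1.left i j)).2
    refine (HomOperations.mem_op (homOperationsPt hmono hbase hcomp hreg hS) (some M) _ _).2
      ((congrArg (fun c => (homOperationsPt hmono hbase hcomp hreg hS).rel (some M) c
        ((M.1.right i).elim 0 a)) e).mpr ?_)
    exact ExtMatrix.Graph.row (M := M.1) (adm := fun _ _ f => f none = 0)
      (f := fun x => (x.elim 0 a : Z ⟶ Y)) (containsIdentities_of_regularMono_le hreg) rfl i

theorem zeroOf_functor_obj (Z : Cᵒᵖ) (Y : C) :
    zeroOf ((((homOperationsPt hmono hbase hcomp hreg hS).functor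
      (homOperationsPt_satisfies hmono hbase hcomp hreg hS)).obj Y).obj Z) = (0 : Z.unop ⟶ Y) :=
  (HomOperations.mem_op (homOperationsPt hmono hbase hcomp hreg hS) none Fin.elim0 _).1
    (Part.get_mem (zero_dom ((((homOperationsPt hmono hbase hcomp hreg hS).functor
      (homOperationsPt_satisfies hmono hbase hcomp hreg hS)).obj Y).obj Z)))

theorem functor_comp_forgetPtS :
    (homOperationsPt hmono hbase hcomp hreg hS).functor
        (homOperationsPt_satisfies hmono hbase hcomp hreg hS) ⋙
      (Functor.whiskeringRight Cᵒᵖ _ _).obj (forgetPtS S) = yonedaPt C :=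
  yonedaPointedBy_eq _ (fun g X => map_zeroOf ((((homOperationsPt hmono hbase hcomp hreg hS).functor
      (homOperationsPt_satisfies hmono hbase hcomp hreg hS)).obj X).map g))
    (fun Z _ _ f => map_zeroOf ((((homOperationsPt hmono hbase hcomp hreg hS).functor
      (homOperationsPt_satisfies hmono hbase hcomp hreg hS)).map f).app Z))
    (zeroOf_functor_obj hmono hbase hcomp hreg hS)

end MatrixEmbedding

end Pointed

theorem theorem1p7 :
    -- the non-pointed case
    (∀ (S : Set Matr) (C : Type u) [Category.{v} C] [HasFiniteLimits C]
      (W : MorphismProperty C),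
      W ≤ MorphismProperty.monomorphisms C →
      W.IsStableUnderBaseChange →
      W.IsStableUnderComposition →
      MorphismProperty.regularMono C ≤ W →
      HasClosedRelations S W →
      ∃ φ : C ⥤ (Cᵒᵖ ⥤ PartS.{v} S),
        φ.Full ∧ φ.Faithful ∧
        PreservesFiniteLimits φ ∧ ReflectsFiniteLimits φ ∧
        (∀ ⦃A B : C⦄ (f : A ⟶ B), W f →
          ∀ X : C, PartAlg.IsClosedMono ((φ.map f).app (Opposite.op X))) ∧
        φ ⋙ (Functor.whiskeringRight Cᵒᵖ _ _).obj (forgetS S) = yoneda) ∧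
    -- the pointed case
    (∀ (S : Set MatrPt) (C : Type u) [Category.{v} C] [HasFiniteLimits C]
      [HasZeroObject C] [HasZeroMorphisms C] (W : MorphismProperty C),
      W ≤ MorphismProperty.monomorphisms C →
      W.IsStableUnderBaseChange →
      W.IsStableUnderComposition →
      MorphismProperty.regularMono C ≤ W →
      HasClosedRelationsPt S W →
      ∃ φ : C ⥤ (Cᵒᵖ ⥤ PartPtS.{v} S),
        φ.Full ∧ φ.Faithful ∧
        PreservesFiniteLimits φ ∧ ReflectsFiniteLimits φ ∧
        (∀ ⦃A B : C⦄ (f : A ⟶ B), W f →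
          ∀ X : C, PartAlg.IsClosedMono ((φ.map f).app (Opposite.op X))) ∧
        φ ⋙ (Functor.whiskeringRight Cᵒᵖ _ _).obj (forgetPtS S) = yonedaPt C) := by
  refine ⟨fun S C _ _ W hmono hbase hcomp hreg hS => ?_,
    fun S C _ _ _ _ W hmono hbase hcomp hreg hS => ?_⟩
  · have sat := homOperations_satisfies hmono hbase hcomp hreg hS
    have hP := homOperations_isClosedFor hmono hbase hcomp hreg hS
    have full := HomOperations.functor_full _ sat
    have faithful := HomOperations.functor_faithful _ sat
    -- Reflection of finite limits comes from full faithfulness.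
    exact ⟨_, full, faithful, hP.preservesFiniteLimits sat, inferInstance, fun A B f hf X =>
      have : Mono f := hmono f hf
      HomOperations.isClosedMono_functor_map _ sat f (fun s Z => hP.closed s f hf) X, rfl⟩
  · have sat := homOperationsPt_satisfies hmono hbase hcomp hreg hS
    have hP := homOperationsPt_isClosedFor hmono hbase hcomp hreg hS
    have full := HomOperations.functor_full _ sat
    have faithful := HomOperations.functor_faithful _ sat
    exact ⟨_, full, faithful, hP.preservesFiniteLimits sat, inferInstance, fun A B f hf X =>
      have : Mono f := hmono f hf
      HomOperations.isClosedMono_functor_map _ sat f (fun s Z => hP.closed s f hf) X,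
      functor_comp_forgetPtS hmono hbase hcomp hreg hS⟩
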